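/- Let $\Pi=\{z\in\mathbb C:\operatorname{Re} z>0\}$ and let $H^\infty(\Pi)$ be the space of bounded holomorphic functions on $\Pi$ with the norm $\|f\|=\sup_{z\in\Pi}|f(z)|$. For $\beta\ge 0$ let $\mathcal L^{\uparrow}_\beta,\mathcal L^{\downarrow}_\beta$ be the bounded operators on $H^\infty(\Pi)$ given by $$\mathcal L^{\uparrow}_\beta f(z)=\frac1{(1+z)^{2\beta}}\,f\Bigl(\frac z{1+z}\Bigr),\qquad \mathcal L^{\downarrow}_\beta f(z)=f(1+z)$$ (principal branch of the power). For $\tau>0$ put $\mathcal M^{\uparrow}_{\beta,\tau}=\tau\mathcal L^{\uparrow}_\beta[1-\tau\mathcal L^{\uparrow}_\beta]^{-1}$ and $\mathcal M^{\downarrow}_{\beta,\tau}=\tau\mathcal L^{\downarrow}_\beta[1-\tau\mathcal L^{\downarrow}_\beta]^{-1}$ whenever the inverses exist. Let $\beta>\frac12$ and $0<\tau_\downarrow,\tau_\uparrow\le 1$. Then the series $$\mathcal M^{\downarrow}_{\beta,\tau_\downarrow}\mathcal M^{\uparrow}_{\beta,\tau_\uparrow}:=\sum_{m,n=1}^\infty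 \tau_\downarrow^m\tau_\uparrow^n\,(\mathcal L^{\downarrow}_\beta)^m(\mathcal L^{\uparrow}_\beta)^n$$ converges (unconditionally) in operator norm; if $\tau_\downarrow,\tau_\uparrow<1$, then $1-\tau_\downarrow\mathcal L^{\downarrow}_\beta$ and $1-\tau_\uparrow\mathcal L^{\uparrow}_\beta$ are invertible and the sum is the product of the operators $\mathcal M^{\downarrow}_{\beta,\tau_\downarrow}$ and $\mathcal M^{\uparrow}_{\beta,\tau_\uparrow}$ defined above. The operator $\mathcal M^{\downarrow}_{\beta,\tau_\downarrow}\mathcal M^{\uparrow}_{\beta,\tau_\uparrow}$ on $H^\infty(\Pi)$ is compact and has a simple leading eigenvalue: there is $\lambda>0$ which is an eigenvalue of algebraic multiplicity one and satisfies $|\mu|<\lambda$ for every other point $\mu$ of the spectrum. -/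

import Mathlib

open scoped BoundedContinuousFunction

noncomputable section

namespace FareyChain

/-- The open right half-plane `Π = {z ∈ ℂ : Re z > 0}`. -/
def rightHalfPlane : Set ℂ := {z | 0 < z.re}

/-- `H^∞(Π)`: the bounded holomorphic functions on `Π`, as a subspace of the bounded continuous
functions on `Π`, from which it inherits the norm `‖f‖ = sup_{z ∈ Π} |f z|`. -/
def HInf : Submodule ℂ (rightHalfPlane →ᵇ ℂ) where
  carrier := {f | ∃ F : ℂ → ℂ, DifferentiableOn ℂ F rightHalfPlane ∧
    ∀ z : rightHalfPlane, f z = F z}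
  zero_mem' := ⟨fun _ => 0, differentiableOn_const 0, fun _ => rfl⟩
  add_mem' := by
    rintro f g ⟨F, hF, hf⟩ ⟨G, hG, hg⟩
    exact ⟨fun z => F z + G z, hF.add hG, fun z => by simp [hf z, hg z]⟩
  smul_mem' := by
    rintro c f ⟨F, hF, hf⟩
    exact ⟨fun z => c * F z, hF.const_mul c, fun z => by simp [hf z]⟩

/-- The function `w · (f ∘ φ)`, for `w, f ∈ H^∞(Π)` and a holomorphic self-map `φ` of `Π`. -/
def weightedCompFun (w : HInf) (φ : ℂ → ℂ) (hφ : DifferentiableOn ℂ φ rightHalfPlane)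
    (hmaps : Set.MapsTo φ rightHalfPlane rightHalfPlane) (f : HInf) : HInf :=
  ⟨BoundedContinuousFunction.ofNormedAddCommGroup
      (fun z : rightHalfPlane => w.1 z * f.1 ⟨φ z, hmaps z.2⟩)
      (w.1.continuous.mul (f.1.continuous.comp
        (Continuous.subtype_mk (continuousOn_iff_continuous_domRestrict.1 hφ.continuousOn) _)))
      (‖w.1‖ * ‖f.1‖)
      (fun z => by
        rw [norm_mul]
        exact mul_le_mul (w.1.norm_coe_le_norm _) (f.1.norm_coe_le_norm _)
          (norm_nonneg _) (norm_nonneg _)), by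
    obtain ⟨W, hW, hw⟩ := w.2
    obtain ⟨F, hF, hf⟩ := f.2
    exact ⟨fun z => W z * F (φ z), hW.mul (hF.comp hφ hmaps), fun z => by
      simp [hw z, hf ⟨φ z, hmaps z.2⟩]⟩⟩

/-- The weighted composition operator `C_{w,φ} f = w · (f ∘ φ)` on `H^∞(Π)`. -/
def weightedComp (w : HInf) (φ : ℂ → ℂ) (hφ : DifferentiableOn ℂ φ rightHalfPlane)
    (hmaps : Set.MapsTo φ rightHalfPlane rightHalfPlane) : HInf →L[ℂ] HInf :=
  LinearMap.mkContinuous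
    { toFun := weightedCompFun w φ hφ hmaps
      map_add' := fun f g => by
        ext z
        simp [weightedCompFun, mul_add]
      map_smul' := fun c f => by
        ext z
        simp [weightedCompFun, mul_left_comm] }
    ‖w‖ (fun f =>
      (weightedCompFun w φ hφ hmaps f).1.norm_le (by positivity) |>.2 fun z => by
        change ‖w.1 z * f.1 ⟨φ z, hmaps z.2⟩‖ ≤ ‖w.1‖ * ‖f.1‖
        rw [norm_mul]
        exact mul_le_mul (w.1.norm_coe_le_norm _) (f.1.norm_coe_le_norm _)
          (norm_nonneg _) (norm_nonneg _))

/-- The constant function `1` in `H^∞(Π)`. -/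
def oneFun : HInf :=
  ⟨BoundedContinuousFunction.const _ 1, fun _ => 1, differentiableOn_const 1, fun _ => rfl⟩

lemma one_add_mem_slitPlane {z : ℂ} (hz : z ∈ rightHalfPlane) : 1 + z ∈ Complex.slitPlane := by
  left
  have h : 0 < z.re := hz
  simp only [Complex.add_re, Complex.one_re]
  linarith

lemma one_add_ne_zero {z : ℂ} (hz : z ∈ rightHalfPlane) : 1 + z ≠ 0 :=
  Complex.slitPlane_ne_zero (one_add_mem_slitPlane hz)

lemma differentiableOn_weight (β : ℝ) :
    DifferentiableOn ℂ (fun z : ℂ => 1 / (1 + z) ^ ((2 * β : ℝ) : ℂ)) rightHalfPlane := by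
  refine DifferentiableOn.div (differentiableOn_const _) ?_ ?_
  · exact ((differentiableOn_const _).add differentiableOn_id).cpow (differentiableOn_const _)
      (fun z hz => one_add_mem_slitPlane hz)
  · intro z hz
    simp [Complex.cpow_eq_zero_iff, one_add_ne_zero hz]

lemma norm_weight_le (β : ℝ) (hβ : 0 ≤ β) {z : ℂ} (hz : z ∈ rightHalfPlane) :
    ‖1 / (1 + z) ^ ((2 * β : ℝ) : ℂ)‖ ≤ 1 := by
  rw [norm_div, norm_one, Complex.norm_cpow_real]
  have h1 : (1 : ℝ) ≤ ‖1 + z‖ := by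
    have h : 0 < z.re := hz
    have h2 := Complex.re_le_norm (1 + z)
    simp only [Complex.add_re, Complex.one_re] at h2
    linarith
  have h3 : (1 : ℝ) ≤ ‖1 + z‖ ^ (2 * β) := Real.one_le_rpow h1 (by positivity)
  exact div_le_one_of_le₀ h3 (by positivity)

/-- The weight `z ↦ (1 + z)^(-2β)` (principal branch) as an element of `H^∞(Π)`, `β ≥ 0`. -/
def weightUp (β : ℝ) (hβ : 0 ≤ β) : HInf :=
  ⟨BoundedContinuousFunction.ofNormedAddCommGroup
      (fun z : rightHalfPlane => 1 / (1 + (z : ℂ)) ^ ((2 * β : ℝ) : ℂ))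
      (continuousOn_iff_continuous_domRestrict.1 (differentiableOn_weight β).continuousOn)
      1 (fun z => norm_weight_le β hβ z.2),
    fun z => 1 / (1 + z) ^ ((2 * β : ℝ) : ℂ), differentiableOn_weight β, fun _ => rfl⟩

lemma differentiableOn_up :
    DifferentiableOn ℂ (fun z : ℂ => z / (1 + z)) rightHalfPlane :=
  differentiableOn_id.div ((differentiableOn_const _).add differentiableOn_id)
    (fun _ hz => one_add_ne_zero hz)

lemma mapsTo_up : Set.MapsTo (fun z : ℂ => z / (1 + z)) rightHalfPlane rightHalfPlane := by
  intro z hz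
  have h : 0 < z.re := hz
  have hn : 0 < Complex.normSq (1 + z) := Complex.normSq_pos.2 (one_add_ne_zero hz)
  change 0 < (z / (1 + z)).re
  rw [Complex.div_re, ← add_div]
  refine div_pos ?_ hn
  simp only [Complex.add_re, Complex.one_re, Complex.add_im, Complex.one_im, zero_add]
  nlinarith [mul_self_nonneg z.im, mul_pos h h]

lemma differentiableOn_down : DifferentiableOn ℂ (fun z : ℂ => 1 + z) rightHalfPlane :=
  (differentiableOn_const _).add differentiableOn_id

lemma mapsTo_down : Set.MapsTo (fun z : ℂ => 1 + z) rightHalfPlane rightHalfPlane := by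
  intro z hz
  have h : 0 < z.re := hz
  change 0 < (1 + z).re
  simp only [Complex.add_re, Complex.one_re]
  linarith

/-- `(L↑_β f)(z) = (1 + z)^(-2β) f(z / (1 + z))`. -/
def LUp (β : ℝ) (hβ : 0 ≤ β) : HInf →L[ℂ] HInf :=
  weightedComp (weightUp β hβ) (fun z => z / (1 + z)) differentiableOn_up mapsTo_up

/-- `(L↓_β f)(z) = f(1 + z)`; it does not depend on `β`. -/
def LDown : HInf →L[ℂ] HInf :=
  weightedComp oneFun (fun z => 1 + z) differentiableOn_down mapsTo_down

/-- `M↑_{β,τ} = τ L↑_β (1 - τ L↑_β)⁻¹`, meaningful when `1 - τ L↑_β` is invertible. -/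
def MUp (β : ℝ) (hβ : 0 ≤ β) (τ : ℝ) : HInf →L[ℂ] HInf :=
  ((τ : ℂ) • LUp β hβ) * Ring.inverse (1 - (τ : ℂ) • LUp β hβ)

/-- `M↓_{β,τ} = τ L↓_β (1 - τ L↓_β)⁻¹`, meaningful when `1 - τ L↓_β` is invertible. -/
def MDown (τ : ℝ) : HInf →L[ℂ] HInf :=
  ((τ : ℂ) • LDown) * Ring.inverse (1 - (τ : ℂ) • LDown)

/-- The term `τ↓^m τ↑^n (L↓_β)^m (L↑_β)^n`, where `m = p.1 + 1 ≥ 1` and `n = p.2 + 1 ≥ 1`. -/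
def clusterTerm (β : ℝ) (hβ : 0 ≤ β) (τd τu : ℝ) (p : ℕ × ℕ) : HInf →L[ℂ] HInf :=
  ((τd : ℂ) ^ (p.1 + 1) * (τu : ℂ) ^ (p.2 + 1)) • (LDown ^ (p.1 + 1) * LUp β hβ ^ (p.2 + 1))

/-- The operator `M↓_{β,τ↓} M↑_{β,τ↑}`, given as the sum over `m, n ≥ 1` of
`τ↓^m τ↑^n (L↓_β)^m (L↑_β)^n` in the operator norm. This is also its meaning when `τ↓ = 1` or
`τ↑ = 1`, where the separate factors are not bounded operators on `H^∞(Π)`. -/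
def clusterOp (β : ℝ) (hβ : 0 ≤ β) (τd τu : ℝ) : HInf →L[ℂ] HInf :=
  ∑' p : ℕ × ℕ, clusterTerm β hβ τd τu p

/-- `lam` is a simple leading eigenvalue of `T`: it is an eigenvalue, of algebraic multiplicity
one, and it strictly exceeds in modulus every other point of the spectrum. -/
def IsSimpleLeadingEigenvalue {E : Type*} [NormedAddCommGroup E] [NormedSpace ℂ E]
    (T : E →L[ℂ] E) (lam : ℂ) : Prop :=
  Module.End.HasEigenvalue (T : Module.End ℂ E) lam ∧
  Module.finrank ℂ (Module.End.maxGenEigenspace (T : Module.End ℂ E) lam) = 1 ∧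
  ∀ μ ∈ spectrum ℂ T, μ ≠ lam → ‖μ‖ < ‖lam‖

end FareyChain

end

/-!
Iterating the two generators gives `(L↓)^m (L↑)^n f (z) = (1 + n(z+m))^(-2β) f(φ(z))` with the
Möbius branch `φ(z) = (z+m) / (1 + n(z+m))` (`ev_clusterTerm`). On `Re z ≥ 0` the weight has modulus
at most `(mn)^(-2β)`, which is summable for `2β > 1`; this gives convergence in operator norm. Each
branch maps `Π` into a compact subset of `Π`, so each term is compact by Cauchy's estimate and the
Arzelà–Ascoli theorem (`isCompactOperator_of_mapsTo`), and so is the sum `T`. For `τ↓, τ↑ < 1` the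
double series is the product of two Neumann series.

The spectral statement is of Perron–Frobenius type. On the positive real axis the weights are
positive and all branches take values in `(0, 1]`, so the restriction to `(0, 1]` is what matters.

*Existence.* `T` preserves the cone `InCone` of functions that are nonincreasing on the positive
axis and dominate their own modulus on vertical lines; on this cone the norm is controlled by values
on `(0, 1]`. Let `lam` be the supremum of the `s` for which some nonzero `f` in the cone satisfies
`s f ≤ T f` on `(0, 1]`. By compactness it is attained. If `k = T f - lam f` were not zero, then
`T k` would be bounded below by a positive constant on `(0, 1]`, because the zeros of the
holomorphic function `k` do not accumulate at `1` while the branches with `n = 1` and large `m` come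
arbitrarily close to `1` (`Admissible.exists_pos_le_op`); then `T f` would satisfy the inequality
with a larger `s`. So the extremal function is an eigenfunction `g`, positive on the axis
(`Admissible.exists_eigenfunction`).

*Uniqueness.* If `T f = μ f` with `|μ| ≥ lam`, then at a maximum of `|f| / g` on `[0, 1]` all the
triangle inequalities are equalities. Hence `f` is proportional to `g` at the images of that point
under all branches, which accumulate at `1 ∈ Π`, and the identity theorem gives `f = c g`
(`Admissible.exists_eq_smul`). The same maximum principle excludes Jordan chains
(`Admissible.eq_zero_of_jordan`). As nonzero spectral values of a compact operator are eigenvalues,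
`lam` is a simple leading eigenvalue.
-/

namespace FareyChain

open Filter Topology

/-! ### Functions in `H^∞(Π)` -/

open Classical in
/-- The value of `f ∈ H^∞(Π)` at a complex number, extended by zero outside `Π`. Unlike the
holomorphic function supplied by membership in `HInf`, it is linear in `f`. -/
noncomputable def ev (f : HInf) (z : ℂ) : ℂ :=
  if h : z ∈ rightHalfPlane then f.1 ⟨z, h⟩ else 0

lemma ev_of_mem (f : HInf) {z : ℂ} (hz : z ∈ rightHalfPlane) : ev f z = f.1 ⟨z, hz⟩ := dif_pos hz

lemma ev_coe (f : HInf) (z : rightHalfPlane) : ev f z = f.1 z := ev_of_mem f z.2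

lemma ofReal_mem {x : ℝ} (hx : 0 < x) : (x : ℂ) ∈ rightHalfPlane := by
  simpa [rightHalfPlane] using hx

lemma isOpen_rightHalfPlane : IsOpen rightHalfPlane :=
  isOpen_lt continuous_const Complex.continuous_re

lemma convex_rightHalfPlane : Convex ℝ rightHalfPlane := convex_halfSpace_re_gt 0

lemma ev_add (f g : HInf) (z : ℂ) : ev (f + g) z = ev f z + ev g z := by
  unfold ev; split_ifs <;> simp

lemma ev_sub (f g : HInf) (z : ℂ) : ev (f - g) z = ev f z - ev g z := by
  unfold ev; split_ifs <;> simp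

lemma ev_smul (c : ℂ) (f : HInf) (z : ℂ) : ev (c • f) z = c * ev f z := by
  unfold ev; split_ifs
  · rfl
  · rw [mul_zero]

lemma ev_zero (z : ℂ) : ev 0 z = 0 := by
  unfold ev; split_ifs <;> rfl

lemma ev_oneFun {z : ℂ} (hz : z ∈ rightHalfPlane) : ev oneFun z = 1 := by
  rw [ev_of_mem _ hz]; rfl

lemma norm_ev_le (f : HInf) (z : ℂ) : ‖ev f z‖ ≤ ‖f‖ := by
  unfold ev; split_ifs
  · exact f.1.norm_coe_le_norm _
  · rw [norm_zero]; exact norm_nonneg f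

lemma HInf_ext {f g : HInf} (h : ∀ z ∈ rightHalfPlane, ev f z = ev g z) : f = g := by
  ext z
  rw [← ev_coe, ← ev_coe]
  exact h z z.2

lemma norm_le_of_ev {f : HInf} {C : ℝ} (hC : 0 ≤ C) (h : ∀ z ∈ rightHalfPlane, ‖ev f z‖ ≤ C) :
    ‖f‖ ≤ C := by
  refine (f.1.norm_le hC).2 fun z => ?_
  rw [← ev_coe]
  exact h z z.2

lemma differentiableOn_ev (f : HInf) : DifferentiableOn ℂ (ev f) rightHalfPlane := by
  obtain ⟨F, hF, hf⟩ := f.2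
  exact hF.congr fun z hz => by rw [ev_of_mem f hz, hf]

/-- Evaluation at a point of the plane, as a bounded functional. -/
noncomputable def evCLM (z : ℂ) : HInf →L[ℂ] ℂ :=
  LinearMap.mkContinuous
    { toFun := fun f => ev f z
      map_add' := fun f g => ev_add f g z
      map_smul' := fun c f => ev_smul c f z } 1 fun f => by
    rw [one_mul]; exact norm_ev_le f z

lemma evCLM_apply (z : ℂ) (f : HInf) : evCLM z f = ev f z := rfl

/-- The identity theorem: zeros of a nonzero function do not accumulate inside `Π`. -/
lemma eq_zero_of_frequently {f : HInf} {z₀ : ℂ} (hz₀ : z₀ ∈ rightHalfPlane)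
    (h : ∃ᶠ z in 𝓝[≠] z₀, ev f z = 0) : f = 0 := by
  refine HInf_ext fun z hz => ?_
  rw [ev_zero]
  exact ((differentiableOn_ev f).analyticOnNhd
    isOpen_rightHalfPlane).eqOn_zero_of_preconnected_of_frequently_eq_zero
    convex_rightHalfPlane.isPreconnected hz₀ h hz

/-- The identity theorem for zeros on a real interval. -/
lemma eq_zero_of_Ioo {f : HInf} {a b : ℝ} (ha : 0 ≤ a) (hab : a < b)
    (h : ∀ x : ℝ, a < x → x < b → ev f x = 0) : f = 0 := by
  have hc : 0 < (a + b) / 2 := by linarith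
  refine eq_zero_of_frequently (ofReal_mem hc) ?_
  have h1 : ∃ᶠ x : ℝ in 𝓝[≠] ((a + b) / 2), ev f x = 0 := by
    refine Eventually.frequently ?_
    filter_upwards [nhdsWithin_le_nhds (Ioo_mem_nhds (by linarith : a < (a + b) / 2)
      (by linarith : (a + b) / 2 < b))] with x hx
    exact h x hx.1 hx.2
  have h2 : Tendsto (fun x : ℝ => (x : ℂ)) (𝓝[≠] ((a + b) / 2)) (𝓝[≠] (((a + b) / 2 : ℝ) : ℂ)) :=
    Complex.continuous_ofReal.continuousAt.continuousWithinAt.tendsto_nhdsWithin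
      fun x hx => by simpa using Complex.ofReal_injective.ne hx
  exact h2.frequently h1

/-- Uniform limits of holomorphic functions are holomorphic. -/
lemma isClosed_HInf : IsClosed (HInf : Set (rightHalfPlane →ᵇ ℂ)) := by
  rw [← isSeqClosed_iff_isClosed]
  intro u g hu hg
  choose F hF hFu using hu
  classical
  refine ⟨fun z => if h : z ∈ rightHalfPlane then g ⟨z, h⟩ else 0, ?_, fun z => by simp⟩
  refine TendstoLocallyUniformlyOn.differentiableOn (φ := atTop) (F := F) ?_
    (Eventually.of_forall hF) isOpen_rightHalfPlane
  refine TendstoUniformlyOn.tendstoLocallyUniformlyOn ?_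
  have := BoundedContinuousFunction.tendsto_iff_tendstoUniformly.1 hg
  rw [Metric.tendstoUniformlyOn_iff]
  rw [Metric.tendstoUniformly_iff] at this
  intro ε hε
  filter_upwards [this ε hε] with n hn z hz
  simpa [hz, hFu] using hn ⟨z, hz⟩

instance : CompleteSpace HInf := isClosed_HInf.completeSpace_coe

/-! ### A compactness criterion -/

/-- By Cauchy's estimate, functions in `H^∞(Π)` are Lipschitz on half-planes inside `Π`. -/
lemma lipschitz_ev (f : HInf) {δ : ℝ} (hδ : 0 < δ) {z w : ℂ} (hz : δ ≤ z.re) (hw : δ ≤ w.re) :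
    ‖ev f z - ev f w‖ ≤ ‖f‖ / (δ / 2) * ‖z - w‖ := by
  have hconv : Convex ℝ {z : ℂ | δ ≤ z.re} := convex_halfSpace_re_ge δ
  refine hconv.norm_image_sub_le_of_norm_deriv_le (f := ev f) (fun x hx => ?_) (fun x hx => ?_)
    hw hz
  · exact (differentiableOn_ev f).differentiableAt
      (isOpen_rightHalfPlane.mem_nhds (lt_of_lt_of_le hδ hx))
  · refine Complex.norm_deriv_le_of_forall_mem_sphere_norm_le (by positivity) ?_
      (fun y _ => norm_ev_le f y)
    refine DifferentiableOn.diffContOnCl ?_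
    refine (differentiableOn_ev f).mono ?_
    refine Metric.closure_ball_subset_closedBall.trans fun y hy => ?_
    have h1 : |(y - x).re| ≤ δ / 2 :=
      (Complex.abs_re_le_norm _).trans (by simpa [dist_eq_norm] using hy)
    have h2 : δ ≤ x.re := hx
    have h3 := (abs_le.1 h1).1
    rw [Complex.sub_re] at h3
    change 0 < y.re
    linarith

/-- A weighted composition operator whose symbol maps `Π` into a compact subset of `Π` is
compact: it factors through the restriction to that subset, and restriction is compact by the
Arzelà–Ascoli theorem. -/
lemma isCompactOperator_of_mapsTo (T : HInf →L[ℂ] HInf) (φ : ℂ → ℂ)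
    (hφ : ContinuousOn φ rightHalfPlane) {δ B : ℝ} (hδ : 0 < δ)
    (hre : ∀ z ∈ rightHalfPlane, δ ≤ (φ z).re) (hB : ∀ z ∈ rightHalfPlane, ‖φ z‖ ≤ B)
    (hT : ∀ f, ∀ z ∈ rightHalfPlane, ev (T f) z = ev (T oneFun) z * ev f (φ z)) :
    IsCompactOperator T := by
  set K : Set ℂ := Metric.closedBall 0 B ∩ {z | δ ≤ z.re} with hK
  have hKc : IsCompact K := (isCompact_closedBall _ _).inter_right
    (isClosed_le continuous_const Complex.continuous_re)
  have : CompactSpace K := isCompact_iff_compactSpace.1 hKc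
  have hKsub : K ⊆ rightHalfPlane := fun z hz => lt_of_lt_of_le hδ hz.2
  -- restriction of functions to `K`
  let ι : C(K, rightHalfPlane) := ⟨fun z => ⟨z, hKsub z.2⟩, by fun_prop⟩
  let R : HInf → (K →ᵇ ℂ) := fun f => f.1.compContinuous ι
  have hRev : ∀ f z, R f z = ev f z := fun f z => (ev_of_mem f (hKsub z.2)).symm
  have hR : IsCompactOperator R := by
    let A : Set (K →ᵇ ℂ) := {g | (∀ z, ‖g z‖ ≤ 1) ∧ LipschitzWith (1 / (δ / 2)).toNNReal g}
    have hA : IsCompact (closure A) := by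
      refine BoundedContinuousFunction.arzela_ascoli (Metric.closedBall 0 1)
        (isCompact_closedBall _ _) A (fun g z hg => by simpa using hg.1 z) ?_
      exact (LipschitzWith.uniformEquicontinuous _ _ fun g => g.2.2).equicontinuous
    refine ⟨closure A, hA, ?_⟩
    filter_upwards [Metric.closedBall_mem_nhds (0 : HInf) one_pos] with f hf
    have hf1 : ‖f‖ ≤ 1 := mem_closedBall_zero_iff.1 hf
    refine subset_closure ⟨fun z => ?_, ?_⟩
    · rw [hRev]; exact (norm_ev_le f z).trans hf1
    · refine LipschitzWith.of_dist_le_mul fun z w => ?_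
      rw [dist_eq_norm, hRev, hRev, Real.coe_toNNReal _ (by positivity), Subtype.dist_eq,
        dist_eq_norm]
      refine (lipschitz_ev f hδ z.2.2 w.2.2).trans ?_
      gcongr
  -- composition with `φ`
  let Φ : C(rightHalfPlane, K) := ⟨fun z => ⟨φ z, by simpa using hB z z.2, hre z z.2⟩,
    Continuous.subtype_mk (continuousOn_iff_continuous_domRestrict.1 hφ) _⟩
  let G : (K →ᵇ ℂ) → (rightHalfPlane →ᵇ ℂ) := fun g => (T oneFun).1 * g.compContinuous Φ
  have hG : Continuous G :=
    continuous_const.mul (BoundedContinuousFunction.continuous_compContinuous Φ)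
  have h1 := hR.continuous_comp hG
  have h2 : G ∘ R = (HInf.subtype ∘ₗ (T : HInf →ₗ[ℂ] HInf)) := by
    funext f
    ext z
    have := hT f z z.2
    rw [ev_coe, ev_coe] at this
    simp only [LinearMap.coe_comp, Function.comp_apply, Submodule.coe_subtype,
      ContinuousLinearMap.coe_coe, this, G, BoundedContinuousFunction.mul_apply,
      BoundedContinuousFunction.compContinuous_apply, hRev]
    rfl
  rw [h2] at h1
  have h3 := h1.codRestrict (fun f => (T f).2) isClosed_HInf
  exact h3

/-! ### The branches and their weights -/

/-- The branch `z ↦ (z + m) / (1 + n (z + m))` with `m = p.1 + 1`, `n = p.2 + 1`. -/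
noncomputable def branch (p : ℕ × ℕ) (z : ℂ) : ℂ :=
  (z + (p.1 + 1)) / (1 + (p.2 + 1) * (z + (p.1 + 1)))

/-- The restriction of `branch p` to the real axis. -/
noncomputable def branchR (p : ℕ × ℕ) (x : ℝ) : ℝ :=
  (x + (p.1 + 1)) / (1 + (p.2 + 1) * (x + (p.1 + 1)))

/-- The weight `τ↓^m τ↑^n (1 + n (z + m))^(-2β)` with `m = p.1 + 1`, `n = p.2 + 1`. -/
noncomputable def weight (β τd τu : ℝ) (p : ℕ × ℕ) (z : ℂ) : ℂ :=
  ((τd : ℂ) ^ (p.1 + 1) * (τu : ℂ) ^ (p.2 + 1)) *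
    (1 / (1 + (p.2 + 1) * (z + (p.1 + 1))) ^ ((2 * β : ℝ) : ℂ))

/-- The restriction of `weight β τd τu p` to the real axis. -/
noncomputable def weightR (β τd τu : ℝ) (p : ℕ × ℕ) (x : ℝ) : ℝ :=
  (τd ^ (p.1 + 1) * τu ^ (p.2 + 1)) * (1 / (1 + (p.2 + 1) * (x + (p.1 + 1))) ^ (2 * β))

lemma denom_re (p : ℕ × ℕ) (z : ℂ) : (1 + (p.2 + 1) * (z + (p.1 + 1)) : ℂ).re =
    1 + (p.2 + 1) * (z.re + (p.1 + 1)) := by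
  simp

lemma denomR_pos (p : ℕ × ℕ) {x : ℝ} (hx : 0 ≤ x) :
    0 < 1 + ((p.2 : ℝ) + 1) * (x + (p.1 + 1)) := by positivity

lemma denom_mem_slitPlane (p : ℕ × ℕ) {z : ℂ} (hz : 0 ≤ z.re) :
    (1 + (p.2 + 1) * (z + (p.1 + 1)) : ℂ) ∈ Complex.slitPlane := by
  left
  rw [denom_re]
  exact denomR_pos p hz

lemma denom_ne_zero (p : ℕ × ℕ) {z : ℂ} (hz : 0 ≤ z.re) :
    (1 + (p.2 + 1) * (z + (p.1 + 1)) : ℂ) ≠ 0 :=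
  Complex.slitPlane_ne_zero (denom_mem_slitPlane p hz)

lemma denomR_le_norm (p : ℕ × ℕ) (z : ℂ) :
    1 + ((p.2 : ℝ) + 1) * (z.re + (p.1 + 1)) ≤ ‖(1 + (p.2 + 1) * (z + (p.1 + 1)) : ℂ)‖ := by
  rw [← denom_re]
  exact Complex.re_le_norm _

lemma branch_ofReal (p : ℕ × ℕ) (x : ℝ) : branch p x = branchR p x := by
  simp [branch, branchR]

lemma weight_ofReal (β τd τu : ℝ) (p : ℕ × ℕ) {x : ℝ} (hx : 0 ≤ x) :
    weight β τd τu p x = weightR β τd τu p x := by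
  have := (denomR_pos p hx).le
  simp only [weight, weightR]
  push_cast [Complex.ofReal_cpow this]
  rfl

lemma weightR_pos {β τd τu : ℝ} (hd0 : 0 < τd) (hu0 : 0 < τu) (p : ℕ × ℕ) {x : ℝ}
    (hx : 0 ≤ x) : 0 < weightR β τd τu p x := by
  have := denomR_pos p hx
  unfold weightR
  positivity

lemma weightR_anti {β τd τu : ℝ} (hβ : 0 ≤ β) (hd0 : 0 < τd) (hu0 : 0 < τu) (p : ℕ × ℕ)
    {x y : ℝ} (hx : 0 ≤ x) (hxy : x ≤ y) : weightR β τd τu p y ≤ weightR β τd τu p x := by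
  have := denomR_pos p hx
  unfold weightR
  gcongr

lemma norm_weight_le_weightR {β τd τu : ℝ} (hβ : 0 ≤ β) (hd0 : 0 < τd) (hu0 : 0 < τu) (p : ℕ × ℕ)
    {z : ℂ} (hz : 0 ≤ z.re) : ‖weight β τd τu p z‖ ≤ weightR β τd τu p z.re := by
  have h1 := denomR_pos p hz
  have h2 := denomR_le_norm p z
  unfold weight weightR
  rw [norm_mul, norm_div, norm_one, Complex.norm_cpow_real, norm_mul, norm_pow, norm_pow,
    Complex.norm_of_nonneg hd0.le, Complex.norm_of_nonneg hu0.le]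
  gcongr

/-- The summable majorant `(mn)^(-2β)` of the weights. -/
noncomputable def majorant (β : ℝ) (p : ℕ × ℕ) : ℝ :=
  1 / ((p.1 : ℝ) + 1) ^ (2 * β) * (1 / ((p.2 : ℝ) + 1) ^ (2 * β))

lemma summable_majorant {β : ℝ} (hβ : 1 / 2 < β) : Summable (majorant β) := by
  have h : Summable fun n : ℕ => 1 / ((n : ℝ) + 1) ^ (2 * β) := by
    have := (summable_nat_add_iff 1).2
      (Real.summable_one_div_nat_rpow (p := 2 * β).2 (by linarith))
    simpa using this
  exact h.mul_of_nonneg h (fun n => by positivity) fun n => by positivity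

lemma weightR_le_majorant {β τd τu : ℝ} (hβ : 0 ≤ β) (hd0 : 0 < τd) (hd1 : τd ≤ 1) (hu0 : 0 < τu)
    (hu1 : τu ≤ 1) (p : ℕ × ℕ) {x : ℝ} (hx : 0 ≤ x) :
    weightR β τd τu p x ≤ majorant β p := by
  unfold weightR majorant
  rw [← one_mul (_ * _ : ℝ)]
  have h1 : τd ^ (p.1 + 1) * τu ^ (p.2 + 1) ≤ 1 :=
    mul_le_one₀ (pow_le_one₀ hd0.le hd1) (by positivity) (pow_le_one₀ hu0.le hu1)
  have h2 : ((p.1 : ℝ) + 1) * (p.2 + 1) ≤ 1 + (p.2 + 1) * (x + (p.1 + 1)) := by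
    have : 0 ≤ ((p.2 : ℝ) + 1) * x := by positivity
    linarith
  rw [one_mul, one_div_mul_one_div, ← Real.mul_rpow (by positivity) (by positivity)]
  calc _ ≤ 1 * (1 / (1 + ((p.2 : ℝ) + 1) * (x + (p.1 + 1))) ^ (2 * β)) := by
        have := denomR_pos p hx
        gcongr
    _ ≤ _ := by rw [one_mul]; gcongr

lemma norm_weight_le_majorant {β τd τu : ℝ} (hβ : 0 ≤ β) (hd0 : 0 < τd) (hd1 : τd ≤ 1)
    (hu0 : 0 < τu) (hu1 : τu ≤ 1) (p : ℕ × ℕ) {z : ℂ} (hz : 0 ≤ z.re) :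
    ‖weight β τd τu p z‖ ≤ majorant β p :=
  (norm_weight_le_weightR hβ hd0 hu0 p hz).trans (weightR_le_majorant hβ hd0 hd1 hu0 hu1 p hz)

lemma branch_eq (p : ℕ × ℕ) {z : ℂ} (hz : 0 ≤ z.re) : branch p z =
    1 / (p.2 + 1) - 1 / (p.2 + 1) * (1 + (p.2 + 1) * (z + (p.1 + 1)))⁻¹ := by
  have h1 := denom_ne_zero p hz
  have h2 : ((p.2 : ℂ) + 1) ≠ 0 := by exact_mod_cast p.2.succ_ne_zero
  unfold branch
  rw [div_eq_iff h1, sub_mul, mul_assoc, inv_mul_cancel₀ h1, mul_one]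
  field_simp
  ring

lemma branchR_eq (p : ℕ × ℕ) {x : ℝ} (hx : 0 ≤ x) : branchR p x =
    1 / (p.2 + 1) - 1 / (p.2 + 1) * (1 + (p.2 + 1) * (x + (p.1 + 1)))⁻¹ := by
  have h1 := (denomR_pos p hx).ne'
  unfold branchR
  field_simp
  ring

lemma branchR_mono (p : ℕ × ℕ) {x y : ℝ} (hx : 0 ≤ x) (hxy : x ≤ y) :
    branchR p x ≤ branchR p y := by
  have h1 := denomR_pos p hx
  rw [branchR_eq p hx, branchR_eq p (hx.trans hxy)]
  gcongr

lemma branchR_pos (p : ℕ × ℕ) {x : ℝ} (hx : 0 ≤ x) : 0 < branchR p x := by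
  unfold branchR; positivity

lemma branchR_le_one (p : ℕ × ℕ) {x : ℝ} (hx : 0 ≤ x) : branchR p x ≤ 1 := by
  unfold branchR
  rw [div_le_one (denomR_pos p hx)]
  have : 0 ≤ (p.2 : ℝ) * (x + (p.1 + 1)) := by positivity
  linarith

/-- A branch maps the vertical line `Re z = x` to a circle meeting the real axis at right angles,
whose leftmost point is the image of `x`. -/
lemma branchR_le_re (p : ℕ × ℕ) {z : ℂ} (hz : 0 ≤ z.re) :
    branchR p z.re ≤ (branch p z).re := by
  have h1 := denomR_pos p hz
  have h2 := denomR_le_norm p z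
  have h3 : ((1 + (p.2 + 1) * (z + (p.1 + 1)) : ℂ)⁻¹).re ≤
      (1 + ((p.2 : ℝ) + 1) * (z.re + (p.1 + 1)))⁻¹ := by
    refine (Complex.re_le_norm _).trans ?_
    rw [norm_inv]
    gcongr
  have h4 : (branch p z).re = 1 / ((p.2 : ℝ) + 1) -
      1 / ((p.2 : ℝ) + 1) * ((1 + (p.2 + 1) * (z + (p.1 + 1)) : ℂ)⁻¹).re := by
    rw [branch_eq p hz, Complex.sub_re]
    have : (1 / ((p.2 : ℂ) + 1)) = ((1 / ((p.2 : ℝ) + 1) : ℝ) : ℂ) := by push_cast; rfl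
    rw [this, Complex.re_ofReal_mul, Complex.ofReal_re]
  rw [branchR_eq p hz, h4]
  gcongr

lemma branchR_zero_le_re (p : ℕ × ℕ) {z : ℂ} (hz : 0 ≤ z.re) :
    branchR p 0 ≤ (branch p z).re :=
  (branchR_mono p le_rfl hz).trans (branchR_le_re p hz)

lemma branch_mem (p : ℕ × ℕ) {z : ℂ} (hz : 0 ≤ z.re) : branch p z ∈ rightHalfPlane :=
  (branchR_pos p le_rfl).trans_le (branchR_zero_le_re p hz)

lemma norm_branch_le (p : ℕ × ℕ) {z : ℂ} (hz : 0 ≤ z.re) : ‖branch p z‖ ≤ 2 := by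
  have h1 : 1 ≤ 1 + ((p.2 : ℝ) + 1) * (z.re + (p.1 + 1)) := by
    have : 0 ≤ ((p.2 : ℝ) + 1) * (z.re + (p.1 + 1)) := by positivity
    linarith
  have h2 := h1.trans (denomR_le_norm p z)
  have h3 : ‖1 / ((p.2 : ℂ) + 1)‖ ≤ 1 := by
    have : ((p.2 : ℂ) + 1) = (((p.2 : ℝ) + 1 : ℝ) : ℂ) := by push_cast; rfl
    rw [norm_div, norm_one, this, Complex.norm_of_nonneg (by positivity)]
    exact div_le_one_of_le₀ (by linarith [Nat.cast_nonneg (α := ℝ) p.2]) (by positivity)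
  rw [branch_eq p hz]
  refine (norm_sub_le _ _).trans ?_
  rw [norm_mul, norm_inv]
  have h4 := inv_le_one_of_one_le₀ h2
  nlinarith [norm_nonneg (1 / ((p.2 : ℂ) + 1)),
    inv_nonneg.2 (norm_nonneg (1 + (p.2 + 1) * (z + (p.1 + 1)) : ℂ))]

lemma continuousOn_branch (p : ℕ × ℕ) : ContinuousOn (branch p) {z | 0 ≤ z.re} :=
  ContinuousOn.div (by fun_prop) (by fun_prop) fun _ hz => denom_ne_zero p hz

lemma continuousOn_weight (β τd τu : ℝ) (p : ℕ × ℕ) :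
    ContinuousOn (weight β τd τu p) {z | 0 ≤ z.re} := by
  refine continuousOn_const.mul (ContinuousOn.div (by fun_prop) ?_ ?_)
  · exact ContinuousOn.cpow_const (by fun_prop) fun z hz => denom_mem_slitPlane p hz
  · intro z hz
    simp [Complex.cpow_eq_zero_iff, denom_ne_zero p hz]

/-! ### The terms of the series -/

lemma ev_LDown (f : HInf) {z : ℂ} (hz : z ∈ rightHalfPlane) : ev (LDown f) z = ev f (1 + z) := by
  rw [ev_of_mem _ hz, ev_of_mem f (mapsTo_down hz)]
  exact one_mul _

lemma ev_LUp (β : ℝ) (hβ : 0 ≤ β) (f : HInf) {z : ℂ} (hz : z ∈ rightHalfPlane) :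
    ev (LUp β hβ f) z = 1 / (1 + z) ^ ((2 * β : ℝ) : ℂ) * ev f (z / (1 + z)) := by
  rw [ev_of_mem _ hz, ev_of_mem f (mapsTo_up hz)]
  rfl

lemma add_nat_mem {z : ℂ} (hz : z ∈ rightHalfPlane) (n : ℕ) : z + n ∈ rightHalfPlane := by
  have : 0 < z.re := hz
  change 0 < (z + n).re
  simp only [Complex.add_re, Complex.natCast_re]
  positivity

lemma ev_LDown_pow (n : ℕ) (f : HInf) {z : ℂ} (hz : z ∈ rightHalfPlane) :
    ev ((LDown ^ n) f) z = ev f (z + n) := by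
  induction n generalizing f with
  | zero => simp
  | succ n ih =>
    rw [pow_succ, mul_apply_eq_comp, ih, ev_LDown _ (add_nat_mem hz n)]
    congr 1
    push_cast
    ring

/-- The principal powers multiply along the iteration, because `1 + z` and `1 + n z` lie in the
right half-plane. -/
lemma ev_LUp_pow (β : ℝ) (hβ : 0 ≤ β) (n : ℕ) (f : HInf) {z : ℂ} (hz : z ∈ rightHalfPlane) :
    ev ((LUp β hβ ^ n) f) z =
      1 / (1 + n * z) ^ ((2 * β : ℝ) : ℂ) * ev f (z / (1 + n * z)) := by
  induction n generalizing f with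
  | zero => simp
  | succ n ih =>
    have hz' : 0 < z.re := hz
    have hn : 0 < (1 + n * z).re := by
      simp only [Complex.add_re, Complex.one_re, Complex.mul_re, Complex.natCast_re, Complex.natCast_im,
        zero_mul, sub_zero]
      positivity
    have hn0 : 1 + n * z ≠ 0 := Complex.slitPlane_ne_zero (.inl hn)
    have hm : 0 < (1 + (n + 1) * z : ℂ).re := by
      have : (1 + (n + 1) * z : ℂ) = 1 + ((n + 1 : ℕ) : ℂ) * z := by push_cast; rfl
      rw [this]
      simp only [Complex.add_re, Complex.one_re, Complex.mul_re, Complex.natCast_re, Complex.natCast_im,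
        zero_mul, sub_zero]
      positivity
    have hm0 : (1 + (n + 1) * z : ℂ) ≠ 0 := Complex.slitPlane_ne_zero (.inl hm)
    have hq : z / (1 + n * z) ∈ rightHalfPlane := by
      change 0 < (z / (1 + n * z)).re
      rw [Complex.div_re, ← add_div]
      refine div_pos ?_ (Complex.normSq_pos.2 hn0)
      simp only [Complex.add_re, Complex.one_re, Complex.mul_re, Complex.natCast_re, Complex.natCast_im,
        zero_mul, sub_zero, Complex.add_im,
        Complex.one_im, Complex.mul_im, add_zero, zero_add]
      have : 0 ≤ (n : ℝ) * (z.re * z.re + z.im * z.im) :=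
        mul_nonneg n.cast_nonneg (add_nonneg (mul_self_nonneg _) (mul_self_nonneg _))
      nlinarith
    have hdiv : 1 + z / (1 + n * z) = (1 + (n + 1) * z) / (1 + n * z) := by
      rw [eq_div_iff hn0, add_mul, div_mul_cancel₀ _ hn0]
      ring
    have hre : 0 < (1 + z / (1 + n * z)).re := by
      have : 0 < (z / (1 + n * z)).re := hq
      simp only [Complex.add_re, Complex.one_re]
      linarith
    rw [pow_succ, mul_apply_eq_comp, ih, ev_LUp _ _ _ hq, ← mul_assoc,
      one_div_mul_one_div]
    have hpow : (1 + n * z) ^ ((2 * β : ℝ) : ℂ) * (1 + z / (1 + n * z)) ^ ((2 * β : ℝ) : ℂ) =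
        (1 + ((n + 1 : ℕ) : ℂ) * z) ^ ((2 * β : ℝ) : ℂ) := by
      have h1 := abs_lt.1 (Complex.abs_arg_lt_pi_div_two_iff.2 (.inl hn))
      have h2 := abs_lt.1 (Complex.abs_arg_lt_pi_div_two_iff.2 (.inl hre))
      have hr0 := Complex.slitPlane_ne_zero (.inl hre)
      have hprod : (1 + n * z) * (1 + z / (1 + n * z)) = 1 + ((n + 1 : ℕ) : ℂ) * z := by
        rw [hdiv, mul_div_cancel₀ _ hn0]
        push_cast
        rfl
      rw [← hprod, Complex.cpow_def_of_ne_zero hn0, Complex.cpow_def_of_ne_zero hr0,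
        Complex.cpow_def_of_ne_zero (mul_ne_zero hn0 hr0), ← Complex.exp_add,
        Complex.log_mul hn0 hr0 ⟨by linarith, by linarith⟩, add_mul]
    rw [hpow, hdiv]
    congr 2
    push_cast
    rw [div_div_div_cancel_right₀ hn0]

lemma ev_clusterTerm (β : ℝ) (hβ : 0 ≤ β) (τd τu : ℝ) (p : ℕ × ℕ) (f : HInf) {z : ℂ}
    (hz : z ∈ rightHalfPlane) :
    ev (clusterTerm β hβ τd τu p f) z = weight β τd τu p z * ev f (branch p z) := by
  have h := add_nat_mem hz (p.1 + 1)
  rw [clusterTerm, smul_apply, ev_smul, mul_apply_eq_comp,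
    ev_LDown_pow _ _ hz, ev_LUp_pow _ _ _ _ h, weight, branch]
  push_cast
  ring

lemma norm_clusterTerm_le {β τd τu : ℝ} (hβ0 : 0 ≤ β) (hd0 : 0 < τd) (hd1 : τd ≤ 1) (hu0 : 0 < τu) (hu1 : τu ≤ 1)
    (p : ℕ × ℕ) : ‖clusterTerm β hβ0 τd τu p‖ ≤ majorant β p := by
  have h0 : 0 ≤ majorant β p := by unfold majorant; positivity
  refine ContinuousLinearMap.opNorm_le_bound _ h0 fun f => ?_
  refine norm_le_of_ev (by positivity) fun z hz => ?_
  have hz' : 0 ≤ z.re := le_of_lt hz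
  rw [ev_clusterTerm _ _ _ _ _ _ hz, norm_mul]
  exact mul_le_mul (norm_weight_le_majorant hβ0 hd0 hd1 hu0 hu1 p hz') (norm_ev_le _ _)
    (norm_nonneg _) h0

/-! ### Series of operators on a Banach space -/

section Banach

variable {E : Type*} [NormedAddCommGroup E] [NormedSpace ℂ E] {ι : Type*}

lemma summable_of_opNorm_le [CompleteSpace E] {T : ι → E →L[ℂ] E} {g : ι → ℝ} (hg : Summable g)
    (h : ∀ i, ‖T i‖ ≤ g i) : Summable T :=
  hg.of_norm_bounded h

lemma hasSum_apply {T : ι → E →L[ℂ] E} {S : E →L[ℂ] E} (h : HasSum T S) (f : E) :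
    HasSum (fun i => T i f) (S f) :=
  (ContinuousLinearMap.apply ℂ E f).hasSum h

lemma isCompactOperator_of_hasSum [CompleteSpace E] {T : ι → E →L[ℂ] E} {S : E →L[ℂ] E} (h : HasSum T S)
    (hT : ∀ i, IsCompactOperator (T i)) : IsCompactOperator S := by
  refine isCompactOperator_of_tendsto h (Eventually.of_forall fun s => ?_)
  induction s using Finset.cons_induction with
  | empty => rw [Finset.sum_empty]; exact isCompactOperator_zero
  | cons i s hi ih =>
    rw [Finset.sum_cons]
    exact (hT i).add ih

lemma norm_smul_lt_one {τ : ℝ} (h0 : 0 < τ) (h1 : τ < 1) {L : E →L[ℂ] E} (hL : ‖L‖ ≤ 1) :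
    ‖(τ : ℂ) • L‖ < 1 := by
  rw [norm_smul, Complex.norm_of_nonneg h0.le]
  nlinarith [norm_nonneg L]

lemma mul_inverse_one_sub {A : Type*} [NormedRing A] [CompleteSpace A] {x : A} (h : ‖x‖ < 1) :
    x * Ring.inverse (1 - x) = ∑' n : ℕ, x ^ (n + 1) := by
  have hs := summable_geometric_of_norm_lt_one h
  rw [← geom_series_eq_inverse x h, ← hs.tsum_mul_left]
  simp_rw [pow_succ']

/-- The product of two Neumann series is a double series. -/
lemma mul_inverse_mul_mul_inverse {A : Type*} [NormedRing A] [NormedAlgebra ℂ A]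
    [CompleteSpace A] {D U : A} {a b : ℂ} (hD : ‖a • D‖ < 1)
    (hU : ‖b • U‖ < 1) :
    (a • D) * Ring.inverse (1 - a • D) * ((b • U) * Ring.inverse (1 - b • U)) =
      ∑' p : ℕ × ℕ, (a ^ (p.1 + 1) * b ^ (p.2 + 1)) • (D ^ (p.1 + 1) * U ^ (p.2 + 1)) := by
  have hs : ∀ {x : A}, ‖x‖ < 1 → Summable fun n : ℕ => ‖x ^ (n + 1)‖ := fun hx =>
    (summable_nat_add_iff 1).2 (summable_norm_geometric_of_norm_lt_one hx)
  rw [mul_inverse_one_sub hD, mul_inverse_one_sub hU,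
    tsum_mul_tsum_of_summable_norm (hs hD) (hs hU)]
  refine tsum_congr fun p => ?_
  rw [smul_pow, smul_pow, smul_mul_smul_comm]

lemma operator_mul_inverse_mul_mul_inverse [CompleteSpace E] {D U : E →L[ℂ] E} {a b : ℂ}
    (hD : ‖a • D‖ < 1) (hU : ‖b • U‖ < 1) :
    (a • D) * Ring.inverse (1 - a • D) * ((b • U) * Ring.inverse (1 - b • U)) =
      ∑' p : ℕ × ℕ, (a ^ (p.1 + 1) * b ^ (p.2 + 1)) • (D ^ (p.1 + 1) * U ^ (p.2 + 1)) :=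
  mul_inverse_mul_mul_inverse (A := E →L[ℂ] E) hD hU

lemma isUnit_one_sub_of_opNorm_lt_one [CompleteSpace E] {L : E →L[ℂ] E} (h : ‖L‖ < 1) :
    IsUnit (1 - L) :=
  isUnit_one_sub_of_norm_lt_one h

end Banach

/-! ### The operator as a series -/

/-- The admissible parameters: `β > 1/2` and `0 < τ↓, τ↑ ≤ 1`. -/
structure Admissible (β τd τu : ℝ) : Prop where
  half_lt : 1 / 2 < β
  td_pos : 0 < τd
  td_le : τd ≤ 1
  tu_pos : 0 < τu
  tu_le : τu ≤ 1

lemma Admissible.nonneg {β τd τu : ℝ} (h : Admissible β τd τu) : 0 ≤ β :=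
  one_half_pos.le.trans h.half_lt.le

/-- The operator `M↓ M↑` for admissible parameters. -/
noncomputable abbrev Admissible.op {β τd τu : ℝ} (h : Admissible β τd τu) : HInf →L[ℂ] HInf :=
  clusterOp β h.nonneg τd τu

variable {β τd τu : ℝ}

lemma Admissible.summable_clusterTerm (h : Admissible β τd τu) :
    Summable (clusterTerm β h.nonneg τd τu) :=
  summable_of_opNorm_le (summable_majorant h.half_lt) fun p =>
    norm_clusterTerm_le h.nonneg h.td_pos h.td_le h.tu_pos h.tu_le p

lemma isCompactOperator_clusterTerm (hβ : 0 ≤ β) (p : ℕ × ℕ) :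
    IsCompactOperator (clusterTerm β hβ τd τu p) := by
  have hsub : rightHalfPlane ⊆ {z | 0 ≤ z.re} := fun z hz => le_of_lt (show 0 < z.re from hz)
  refine isCompactOperator_of_mapsTo _ (branch p) ((continuousOn_branch p).mono hsub)
    (branchR_pos p le_rfl) (fun z hz => branchR_zero_le_re p (hsub hz))
    (fun z hz => norm_branch_le p (hsub hz)) fun f z hz => ?_
  rw [ev_clusterTerm _ _ _ _ _ _ hz, ev_clusterTerm _ _ _ _ _ _ hz,
    ev_oneFun (branch_mem p (hsub hz)), mul_one]

lemma Admissible.isCompactOperator_op (h : Admissible β τd τu) : IsCompactOperator h.op :=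
  isCompactOperator_of_hasSum h.summable_clusterTerm.hasSum
    fun p => isCompactOperator_clusterTerm h.nonneg p

lemma norm_LDown_le : ‖LDown‖ ≤ 1 := by
  refine ContinuousLinearMap.opNorm_le_bound _ zero_le_one fun f => ?_
  refine norm_le_of_ev (by positivity) fun z hz => ?_
  rw [ev_LDown _ hz, one_mul]
  exact norm_ev_le _ _

lemma norm_LUp_le (hβ : 0 ≤ β) : ‖LUp β hβ‖ ≤ 1 := by
  refine ContinuousLinearMap.opNorm_le_bound _ zero_le_one fun f => ?_
  refine norm_le_of_ev (by positivity) fun z hz => ?_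
  rw [ev_LUp _ _ _ hz, norm_mul]
  exact mul_le_mul (norm_weight_le β hβ hz) (norm_ev_le _ _) (norm_nonneg _) zero_le_one

/-- Below the threshold the double series is the product of two Neumann series. -/
lemma clusterOp_eq_mul (hβ : 0 ≤ β) (hd0 : 0 < τd) (hd1 : τd < 1) (hu0 : 0 < τu) (hu1 : τu < 1) :
    clusterOp β hβ τd τu = MDown τd * MUp β hβ τu := by
  have hd := norm_smul_lt_one hd0 hd1 norm_LDown_le
  have hu := norm_smul_lt_one hu0 hu1 (norm_LUp_le hβ)
  exact (operator_mul_inverse_mul_mul_inverse hd hu).symm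

/-- The series `∑ w_p(z) f(φ_p(z))` defining `M↓ M↑ f`. It makes sense, and is continuous, on the
closed half-plane. -/
noncomputable def series (β τd τu : ℝ) (f : HInf) (z : ℂ) : ℂ :=
  ∑' p, weight β τd τu p z * ev f (branch p z)

lemma Admissible.norm_term_le (h : Admissible β τd τu) (f : HInf) (p : ℕ × ℕ) {z : ℂ}
    (hz : 0 ≤ z.re) : ‖weight β τd τu p z * ev f (branch p z)‖ ≤ majorant β p * ‖f‖ := by
  rw [norm_mul]
  refine mul_le_mul
    (norm_weight_le_majorant h.nonneg h.td_pos h.td_le h.tu_pos h.tu_le p hz) (norm_ev_le _ _)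
    (norm_nonneg _) ?_
  unfold majorant
  positivity

lemma Admissible.hasSum_series (h : Admissible β τd τu) (f : HInf) {z : ℂ} (hz : 0 ≤ z.re) :
    HasSum (fun p => weight β τd τu p z * ev f (branch p z)) (series β τd τu f z) :=
  (((summable_majorant h.half_lt).mul_right ‖f‖).of_norm_bounded
    fun p => h.norm_term_le f p hz).hasSum

lemma Admissible.ev_op (h : Admissible β τd τu) (f : HInf) {z : ℂ} (hz : z ∈ rightHalfPlane) :
    ev (h.op f) z = series β τd τu f z := by
  have h1 : HasSum (fun p => clusterTerm β h.nonneg τd τu p f) (h.op f) :=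
    hasSum_apply h.summable_clusterTerm.hasSum f
  have h2 := (evCLM z).hasSum h1
  simp only [evCLM_apply, ev_clusterTerm _ _ _ _ _ _ hz] at h2
  exact h2.unique (h.hasSum_series f (le_of_lt hz))

lemma Admissible.continuousOn_series (h : Admissible β τd τu) (f : HInf) :
    ContinuousOn (series β τd τu f) {z | 0 ≤ z.re} := by
  refine continuousOn_tsum (fun p => (continuousOn_weight β τd τu p).mul ?_)
    ((summable_majorant h.half_lt).mul_right ‖f‖) fun p z hz => h.norm_term_le f p hz
  exact (differentiableOn_ev f).continuousOn.comp (continuousOn_branch p)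
    fun z hz => branch_mem p hz

lemma Admissible.hasSum_re (h : Admissible β τd τu) (f : HInf) {x : ℝ} (hx : 0 ≤ x) :
    HasSum (fun p => weightR β τd τu p x * (ev f (branchR p x)).re) (series β τd τu f x).re := by
  have h1 := Complex.hasSum_re (h.hasSum_series f (z := x) (by simpa using hx))
  simpa only [weight_ofReal _ _ _ _ hx, branch_ofReal, Complex.re_ofReal_mul] using h1

/-- A single term bounds the series from below when `f` is nonnegative on `(0, 1]`. -/
lemma Admissible.term_le_series (h : Admissible β τd τu) {f : HInf}
    (hf : ∀ x : ℝ, 0 < x → x ≤ 1 → 0 ≤ (ev f x).re) (p : ℕ × ℕ) {x : ℝ} (hx : 0 ≤ x) :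
    weightR β τd τu p x * (ev f (branchR p x)).re ≤ (series β τd τu f x).re :=
  le_hasSum (h.hasSum_re f hx) p fun q _ => mul_nonneg
    (weightR_pos h.td_pos h.tu_pos q hx).le (hf _ (branchR_pos q hx) (branchR_le_one q hx))

lemma Admissible.series_nonneg (h : Admissible β τd τu) {f : HInf}
    (hf : ∀ x : ℝ, 0 < x → x ≤ 1 → 0 ≤ (ev f x).re) {x : ℝ} (hx : 0 ≤ x) :
    0 ≤ (series β τd τu f x).re :=
  (h.hasSum_re f hx).nonneg fun q => mul_nonneg
    (weightR_pos h.td_pos h.tu_pos q hx).le (hf _ (branchR_pos q hx) (branchR_le_one q hx))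

lemma Admissible.op_nonneg (h : Admissible β τd τu) {f : HInf}
    (hf : ∀ x : ℝ, 0 < x → x ≤ 1 → 0 ≤ (ev f x).re) {x : ℝ} (hx : 0 < x) :
    0 ≤ (ev (h.op f) x).re := by
  rw [h.ev_op f (ofReal_mem hx)]
  exact h.series_nonneg hf hx.le

/-! ### An invariant cone -/

/-- The cone of functions that are nonincreasing on the positive real axis and whose modulus on
each vertical line is bounded by the value on the real axis (in particular they are nonnegative
there). On this cone the norm of `H^∞(Π)` is governed by the values on `(0, 1]`. -/
structure InCone (f : HInf) : Prop where
  norm_le : ∀ z ∈ rightHalfPlane, ‖ev f z‖ ≤ (ev f z.re).re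
  anti : ∀ x y : ℝ, 0 < x → x ≤ y → (ev f y).re ≤ (ev f x).re

lemma InCone.norm_ofReal_le {f : HInf} (hf : InCone f) {x : ℝ} (hx : 0 < x) :
    ‖ev f x‖ ≤ (ev f x).re := by
  simpa using hf.norm_le x (ofReal_mem hx)

lemma InCone.nonneg {f : HInf} (hf : InCone f) {x : ℝ} (hx : 0 < x) : 0 ≤ (ev f x).re :=
  (norm_nonneg _).trans (hf.norm_ofReal_le hx)

lemma InCone.eq_ofReal {f : HInf} (hf : InCone f) {x : ℝ} (hx : 0 < x) :
    ev f x = ((ev f x).re : ℂ) := by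
  have h1 := (Complex.re_eq_norm.1 (le_antisymm (Complex.re_le_norm _) (hf.norm_ofReal_le hx)))
  exact Complex.ext (by simp) (by simpa using (Complex.nonneg_iff.1 h1).2.symm)

lemma inCone_oneFun : InCone oneFun where
  norm_le z hz := by simp [ev_oneFun hz, ev_oneFun (ofReal_mem (show 0 < z.re from hz))]
  anti x y hx hxy := by rw [ev_oneFun (ofReal_mem hx), ev_oneFun (ofReal_mem (hx.trans_le hxy))]

lemma re_ev_smul (c : ℝ) (f : HInf) (z : ℂ) : (ev ((c : ℂ) • f) z).re = c * (ev f z).re := by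
  rw [ev_smul, Complex.re_ofReal_mul]

lemma InCone.smul {f : HInf} (hf : InCone f) {c : ℝ} (hc : 0 ≤ c) : InCone ((c : ℂ) • f) where
  norm_le z hz := by
    rw [re_ev_smul, ev_smul, norm_mul, Complex.norm_of_nonneg hc]
    exact mul_le_mul_of_nonneg_left (hf.norm_le z hz) hc
  anti x y hx hxy := by
    rw [re_ev_smul, re_ev_smul]
    exact mul_le_mul_of_nonneg_left (hf.anti x y hx hxy) hc

lemma tendsto_ev {u : ℕ → HInf} {f : HInf} (h : Tendsto u atTop (𝓝 f)) (z : ℂ) :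
    Tendsto (fun n => ev (u n) z) atTop (𝓝 (ev f z)) :=
  ((evCLM z).continuous.tendsto f).comp h

lemma tendsto_re_ev {u : ℕ → HInf} {f : HInf} (h : Tendsto u atTop (𝓝 f)) (z : ℂ) :
    Tendsto (fun n => (ev (u n) z).re) atTop (𝓝 (ev f z).re) :=
  (Complex.continuous_re.tendsto _).comp (tendsto_ev h z)

lemma InCone.of_tendsto {u : ℕ → HInf} {f : HInf} (h : Tendsto u atTop (𝓝 f))
    (hu : ∀ n, InCone (u n)) : InCone f where
  norm_le z hz := le_of_tendsto_of_tendsto' (tendsto_ev h z).norm (tendsto_re_ev h _)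
    fun n => (hu n).norm_le z hz
  anti x y hx hxy := le_of_tendsto_of_tendsto' (tendsto_re_ev h _) (tendsto_re_ev h _)
    fun n => (hu n).anti x y hx hxy

lemma InCone.norm_le_of_le {f : HInf} (hf : InCone f) {C : ℝ}
    (hC : ∀ x : ℝ, 0 < x → x ≤ 1 → (ev f x).re ≤ C) : ‖f‖ ≤ C := by
  refine norm_le_of_ev ((hf.nonneg one_pos).trans (hC 1 one_pos le_rfl)) fun z hz => ?_
  have hz' : 0 < z.re := hz
  have hm : 0 < min z.re 1 := lt_min hz' one_pos
  exact ((hf.norm_le z hz).trans (hf.anti _ _ hm (min_le_left _ _))).trans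
    (hC _ hm (min_le_right _ _))

lemma InCone.pos {f : HInf} (hf : InCone f) (hf0 : f ≠ 0) {x : ℝ} (hx : 0 < x) :
    0 < (ev f x).re := by
  refine (hf.nonneg hx).lt_of_ne fun h0 => hf0 ?_
  refine eq_zero_of_Ioo hx.le (lt_add_one x) fun y hy _ => ?_
  have hy0 := hx.trans hy
  have h1 : (ev f y).re = 0 :=
    le_antisymm ((hf.anti x y hx hy.le).trans h0.symm.le) (hf.nonneg hy0)
  rw [hf.eq_ofReal hy0, h1, Complex.ofReal_zero]

/-- The operator preserves the cone: weights are largest, in modulus, on the real axis and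
decrease along it, while the branches move vertical lines to the right of the images of their
real points. -/
lemma Admissible.inCone_op (h : Admissible β τd τu) {f : HInf} (hf : InCone f) :
    InCone (h.op f) where
  norm_le z hz := by
    have hz' : 0 < z.re := hz
    rw [h.ev_op f hz, h.ev_op f (ofReal_mem hz')]
    have hs := h.hasSum_re f hz'.le
    rw [← (h.hasSum_series f hz'.le).tsum_eq]
    refine tsum_of_norm_bounded hs fun p => ?_
    rw [norm_mul]
    refine mul_le_mul (norm_weight_le_weightR h.nonneg h.td_pos h.tu_pos p hz'.le) ?_
      (norm_nonneg _) (weightR_pos h.td_pos h.tu_pos p hz'.le).le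
    exact (hf.norm_le _ (branch_mem p hz'.le)).trans
      (hf.anti _ _ (branchR_pos p hz'.le) (branchR_le_re p hz'.le))
  anti x y hx hxy := by
    have hy := hx.trans_le hxy
    rw [h.ev_op f (ofReal_mem hx), h.ev_op f (ofReal_mem hy)]
    refine hasSum_le (fun p => ?_) (h.hasSum_re f hy.le) (h.hasSum_re f hx.le)
    exact mul_le_mul (weightR_anti h.nonneg h.td_pos h.tu_pos p hx.le hxy)
      (hf.anti _ _ (branchR_pos p hx.le) (branchR_mono p hx.le hxy))
      (hf.nonneg (branchR_pos p hy.le)) (weightR_pos h.td_pos h.tu_pos p hx.le).le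

/-! ### Existence of a positive eigenfunction -/

/-- `f` is a nonzero element of the cone with `s f ≤ M↓ M↑ f` on `(0, 1]`. -/
structure IsSub (h : Admissible β τd τu) (s : ℝ) (f : HInf) : Prop where
  cone : InCone f
  ne_zero : f ≠ 0
  le : ∀ x : ℝ, 0 < x → x ≤ 1 → s * (ev f x).re ≤ (ev (h.op f) x).re

lemma re_ev_le_norm (f : HInf) (z : ℂ) : (ev f z).re ≤ ‖f‖ :=
  (Complex.re_le_norm _).trans (norm_ev_le f z)

lemma IsSub.mul_norm_le {h : Admissible β τd τu} {s : ℝ} {f : HInf} (hs : 0 < s)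
    (hf : IsSub h s f) : s * ‖f‖ ≤ ‖h.op f‖ := by
  rw [mul_comm, ← le_div_iff₀ hs]
  refine hf.cone.norm_le_of_le fun x hx hx1 => ?_
  rw [le_div_iff₀ hs, mul_comm]
  exact (hf.le x hx hx1).trans (re_ev_le_norm _ _)

lemma IsSub.op_ne_zero {h : Admissible β τd τu} {s : ℝ} {f : HInf} (hs : 0 < s)
    (hf : IsSub h s f) : h.op f ≠ 0 := by
  have h1 := hf.mul_norm_le hs
  have h2 : 0 < s * ‖f‖ := mul_pos hs (norm_pos_iff.2 hf.ne_zero)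
  exact norm_pos_iff.1 (h2.trans_le h1)

lemma re_ev_op_sub_smul (h : Admissible β τd τu) (s : ℝ) (f : HInf) (z : ℂ) :
    (ev (h.op f - (s : ℂ) • f) z).re = (ev (h.op f) z).re - s * (ev f z).re := by
  rw [ev_sub, Complex.sub_re, re_ev_smul]

lemma IsSub.sub_nonneg {h : Admissible β τd τu} {s : ℝ} {f : HInf} (hf : IsSub h s f) (x : ℝ)
    (hx : 0 < x) (hx1 : x ≤ 1) : 0 ≤ (ev (h.op f - (s : ℂ) • f) x).re := by
  rw [re_ev_op_sub_smul]
  linarith [hf.le x hx hx1]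

lemma op_op_sub_smul (h : Admissible β τd τu) (s : ℝ) (f : HInf) :
    h.op (h.op f) - (s : ℂ) • h.op f = h.op (h.op f - (s : ℂ) • f) := by
  rw [map_sub, map_smul]

lemma IsSub.op_le {h : Admissible β τd τu} {s : ℝ} {f : HInf} (hf : IsSub h s f) (x : ℝ)
    (hx : 0 < x) : s * (ev (h.op f) x).re ≤ (ev (h.op (h.op f)) x).re := by
  have := h.op_nonneg hf.sub_nonneg hx
  rw [← op_op_sub_smul, re_ev_op_sub_smul] at this
  linarith

lemma continuousOn_re_ev (f : HInf) : ContinuousOn (fun x : ℝ => (ev f x).re) (Set.Ioi 0) :=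
  Complex.continuous_re.comp_continuousOn ((differentiableOn_ev f).continuousOn.comp
    Complex.continuous_ofReal.continuousOn fun _ hx => ofReal_mem hx)

lemma branchR_snd_zero (m : ℕ) {x : ℝ} (hx : 0 ≤ x) :
    branchR (m, 0) x = 1 - 1 / (x + m + 2) := by
  have h1 : x + m + 2 ≠ 0 := by positivity
  have h2 : (1 : ℝ) + (((0 : ℕ) : ℝ) + 1) * (x + (m + 1)) = x + m + 2 := by push_cast; ring
  simp only [branchR, h2]
  rw [eq_sub_iff_add_eq, ← add_div, div_eq_one_iff_eq h1]
  ring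

/-- Strict positivity: if `k` is real and nonnegative on `(0, 1]` and not identically zero, then
its image is bounded below by a positive constant on `(0, 1]`. The zeros of `k` do not accumulate
at `1`, and the branches with `n = 1` and large `m` map `[0, 1]` arbitrarily close to `1`. -/
lemma Admissible.exists_pos_le_op (h : Admissible β τd τu) {k : HInf} (hk0 : k ≠ 0)
    (hre : ∀ x : ℝ, 0 < x → ev k x = ((ev k x).re : ℂ))
    (hk : ∀ x : ℝ, 0 < x → x ≤ 1 → 0 ≤ (ev k x).re) :
    ∃ η : ℝ, 0 < η ∧ ∀ x : ℝ, 0 < x → x ≤ 1 → η ≤ (ev (h.op k) x).re := by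
  have h1 : ∀ᶠ x : ℝ in 𝓝[<] 1, ev k x ≠ 0 := by
    have h2 : ∀ᶠ z : ℂ in 𝓝[≠] ((1 : ℝ) : ℂ), ev k z ≠ 0 := by
      by_contra hcon
      refine hk0 (eq_zero_of_frequently (ofReal_mem one_pos) ?_)
      simpa [Filter.not_eventually] using hcon
    have h3 : Tendsto (fun x : ℝ => (x : ℂ)) (𝓝[<] 1) (𝓝[≠] ((1 : ℝ) : ℂ)) :=
      Complex.continuous_ofReal.continuousAt.continuousWithinAt.tendsto_nhdsWithin
        fun x hx => Complex.ofReal_injective.ne (ne_of_lt hx)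
    exact h3.eventually h2
  obtain ⟨a, ha1, ha⟩ := (mem_nhdsLT_iff_exists_Ioo_subset).1 h1
  have ha1 : a < 1 := ha1
  obtain ⟨M, hM⟩ := exists_nat_one_div_lt (sub_pos.2 ha1)
  set p : ℕ × ℕ := (M, 0)
  have hb : ∀ x : ℝ, 0 ≤ x → branchR p x = 1 - 1 / (x + M + 2) := fun x hx =>
    branchR_snd_zero M hx
  have hmem : ∀ y ∈ Set.Icc (branchR p 0) (branchR p 1), 0 < y ∧ 0 < (ev k y).re := by
    intro y hy
    have hy0 : 0 < y := (branchR_pos p le_rfl).trans_le hy.1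
    have hy1 : y < 1 := by
      refine hy.2.trans_lt ?_
      rw [hb 1 zero_le_one]
      have : (0 : ℝ) < 1 / (1 + M + 2) := by positivity
      linarith
    have hya : a < y := by
      refine lt_of_lt_of_le ?_ hy.1
      rw [hb 0 le_rfl]
      have : (1 : ℝ) / (0 + M + 2) ≤ 1 / (M + 1) :=
        one_div_le_one_div_of_le (by positivity) (by linarith)
      linarith
    refine ⟨hy0, (hk y hy0 hy1.le).lt_of_ne fun h0 => ha ⟨hya, hy1⟩ ?_⟩
    rw [hre y hy0, ← h0, Complex.ofReal_zero]
  have hle : branchR p 0 ≤ branchR p 1 := branchR_mono p le_rfl zero_le_one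
  obtain ⟨y₀, hy₀, hmin⟩ := (isCompact_Icc (a := branchR p 0) (b := branchR p 1)).exists_isMinOn
    ⟨_, Set.left_mem_Icc.2 hle⟩ ((continuousOn_re_ev k).mono fun y hy => (hmem y hy).1)
  have hw := weightR_pos (β := β) h.td_pos h.tu_pos p zero_le_one
  refine ⟨weightR β τd τu p 1 * (ev k y₀).re, mul_pos hw (hmem y₀ hy₀).2, fun x hx hx1 => ?_⟩
  rw [h.ev_op k (ofReal_mem hx)]
  refine le_trans ?_ (h.term_le_series hk p hx.le)
  exact mul_le_mul (weightR_anti h.nonneg h.td_pos h.tu_pos p hx.le hx1)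
    (hmin ⟨branchR_mono p le_rfl hx.le, branchR_mono p hx.le hx1⟩) (hmem y₀ hy₀).2.le
    (weightR_pos h.td_pos h.tu_pos p hx.le).le

/-- A subsolution that is not an eigenfunction can be improved. -/
lemma IsSub.exists_improvement {h : Admissible β τd τu} {s : ℝ} {f : HInf} (hs : 0 < s)
    (hf : IsSub h s f) (hne : h.op f ≠ (s : ℂ) • f) : ∃ ε : ℝ, 0 < ε ∧ IsSub h (s + ε) (h.op f) := by
  obtain ⟨η, hη, hle⟩ := h.exists_pos_le_op (sub_ne_zero.2 hne)
    (fun x hx => by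
      rw [re_ev_op_sub_smul, ev_sub, ev_smul, hf.cone.eq_ofReal hx,
        (h.inCone_op hf.cone).eq_ofReal hx]
      push_cast
      simp) hf.sub_nonneg
  have hn : 0 < ‖h.op f‖ := norm_pos_iff.2 (hf.op_ne_zero hs)
  refine ⟨η / ‖h.op f‖, div_pos hη hn, h.inCone_op hf.cone, hf.op_ne_zero hs, fun x hx hx1 => ?_⟩
  have h1 := hle x hx hx1
  rw [← op_op_sub_smul, re_ev_op_sub_smul] at h1
  have h2 : η / ‖h.op f‖ * (ev (h.op f) x).re ≤ η := by
    rw [div_mul_eq_mul_div, div_le_iff₀ hn]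
    exact mul_le_mul_of_nonneg_left (re_ev_le_norm _ _) hη.le
  rw [add_mul]
  linarith

lemma exists_tendsto_subseq_of_isCompactOperator {E : Type*} [NormedAddCommGroup E]
    [NormedSpace ℂ E] {T : E →L[ℂ] E} (hT : IsCompactOperator T) {u : ℕ → E}
    (hu : ∀ n, ‖u n‖ ≤ 1) :
    ∃ F : E, ∃ φ : ℕ → ℕ, StrictMono φ ∧ Tendsto (fun n => T (u (φ n))) atTop (𝓝 F) := by
  obtain ⟨F, -, φ, hφ, hF⟩ := (IsCompactOperator.isCompact_closure_image_closedBall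
    (f := (T : E →ₗ[ℂ] E)) hT 1).tendsto_subseq (x := fun n => T (u n))
    fun n => subset_closure ⟨u n, by simpa using hu n, rfl⟩
  exact ⟨F, φ, hφ, hF⟩

/-- The largest `s` admitting a subsolution (the Collatz–Wielandt number) is attained, by
compactness, and a maximal subsolution is an eigenfunction. -/
lemma Admissible.exists_eigenfunction (h : Admissible β τd τu) :
    ∃ lam : ℝ, 0 < lam ∧ ∃ f : HInf, InCone f ∧ f ≠ 0 ∧ h.op f = (lam : ℂ) • f := by
  have hone : oneFun ≠ 0 := fun h0 => by
    have := ev_oneFun (ofReal_mem one_pos)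
    rw [h0, ev_zero] at this
    exact zero_ne_one this
  have hs₀ := weightR_pos (β := β) h.td_pos h.tu_pos (0, 0) zero_le_one
  set s₀ := weightR β τd τu (0, 0) 1 with hs₀def
  -- the restriction to `s₀ ≤ s` keeps approximating sequences away from zero
  let Q : Set ℝ := {s | s₀ ≤ s ∧ ∃ f, IsSub h s f}
  -- the constant `1` is a subsolution for `s₀`, the least value of the first weight on `(0, 1]`
  have hQ₀ : s₀ ∈ Q := by
    refine ⟨le_rfl, oneFun, inCone_oneFun, hone, fun x hx hx1 => ?_⟩
    have hx' := branchR_pos (0, 0) hx.le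
    have h1 := h.term_le_series (f := oneFun)
      (fun y hy _ => by rw [ev_oneFun (ofReal_mem hy)]; exact zero_le_one) (0, 0) hx.le
    rw [ev_oneFun (ofReal_mem hx')] at h1
    rw [h.ev_op _ (ofReal_mem hx), ev_oneFun (ofReal_mem hx)]
    refine le_trans ?_ h1
    rw [Complex.one_re, mul_one, mul_one]
    exact weightR_anti h.nonneg h.td_pos h.tu_pos _ hx.le hx1
  have hQb : BddAbove Q := by
    refine ⟨‖h.op‖, ?_⟩
    rintro s ⟨hs, f, hf⟩
    have h1 := (hf.mul_norm_le (hs₀.trans_le hs)).trans (h.op.le_opNorm f)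
    exact le_of_mul_le_mul_right h1 (norm_pos_iff.2 hf.ne_zero)
  obtain ⟨s, -, hslim, hsQ⟩ := exists_seq_tendsto_sSup ⟨s₀, hQ₀⟩ hQb
  set lam := sSup Q with hlam
  have hlam0 : 0 < lam := hs₀.trans_le (le_csSup hQb hQ₀)
  have hsp : ∀ n, 0 < s n := fun n => hs₀.trans_le (hsQ n).1
  -- subsolutions of norm one
  have hex : ∀ n, ∃ f, IsSub h (s n) f ∧ ‖f‖ = 1 := by
    intro n
    obtain ⟨f, hf⟩ := (hsQ n).2
    have hn : 0 < ‖f‖ := norm_pos_iff.2 hf.ne_zero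
    have hn' : ((‖f‖⁻¹ : ℝ) : ℂ) ≠ 0 := Complex.ofReal_ne_zero.2 (inv_ne_zero hn.ne')
    refine ⟨((‖f‖⁻¹ : ℝ) : ℂ) • f, ⟨hf.cone.smul (by positivity), smul_ne_zero hn' hf.ne_zero,
      fun x hx hx1 => ?_⟩, ?_⟩
    · rw [map_smul, re_ev_smul, re_ev_smul, mul_left_comm]
      exact mul_le_mul_of_nonneg_left (hf.le x hx hx1) (by positivity)
    · rw [norm_smul, Complex.norm_of_nonneg (by positivity), inv_mul_cancel₀ hn.ne']
  choose f hf hf1 using hex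
  obtain ⟨F, φ, hφ, hF⟩ := exists_tendsto_subseq_of_isCompactOperator h.isCompactOperator_op
    fun n => (hf1 n).le
  -- the images `T (f n)` are again subsolutions, and their norms stay above `s₀`
  have hsub : IsSub h lam F := by
    refine ⟨InCone.of_tendsto hF fun n => h.inCone_op (hf _).cone, ?_, fun x hx hx1 => ?_⟩
    · have h1 : s₀ ≤ ‖F‖ := by
        refine ge_of_tendsto' hF.norm fun n => ?_
        have h2 := (hf (φ n)).mul_norm_le (hsp _)
        rw [hf1, mul_one] at h2
        exact (hsQ _).1.trans h2
      exact norm_pos_iff.1 (hs₀.trans_le h1)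
    · refine le_of_tendsto_of_tendsto' ((hslim.comp hφ.tendsto_atTop).mul (tendsto_re_ev hF x))
        (tendsto_re_ev ((h.op.continuous.tendsto F).comp hF) x) fun n => ?_
      exact (hf (φ n)).op_le x hx
  refine ⟨lam, hlam0, F, hsub.cone, hsub.ne_zero, ?_⟩
  by_contra hne
  obtain ⟨ε, hε, hsub'⟩ := hsub.exists_improvement hlam0 hne
  have h1 : lam + ε ≤ lam :=
    le_csSup hQb ⟨by linarith [le_csSup hQb hQ₀], _, hsub'⟩
  linarith

/-! ### The maximum principle on the unit interval -/

lemma series_smul (c : ℂ) (f : HInf) (z : ℂ) :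
    series β τd τu (c • f) z = c * series β τd τu f z := by
  rw [series, series, ← tsum_mul_left]
  exact tsum_congr fun p => by rw [ev_smul, mul_left_comm]

/-- The continuous extension to `[0, ∞)` of an eigenfunction `g` for the eigenvalue `lam`. -/
noncomputable def extend (β τd τu lam : ℝ) (g : HInf) (x : ℝ) : ℝ :=
  lam⁻¹ * (series β τd τu g x).re

lemma Admissible.continuousOn_series_ofReal (h : Admissible β τd τu) (f : HInf) :
    ContinuousOn (fun x : ℝ => series β τd τu f x) (Set.Icc 0 1) :=
  (h.continuousOn_series f).comp Complex.continuous_ofReal.continuousOn fun x hx => by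
    simpa using hx.1

lemma Admissible.continuousOn_extend (h : Admissible β τd τu) (lam : ℝ) (g : HInf) :
    ContinuousOn (extend β τd τu lam g) (Set.Icc 0 1) :=
  continuousOn_const.mul (Complex.continuous_re.comp_continuousOn (h.continuousOn_series_ofReal g))

lemma Admissible.extend_eq (h : Admissible β τd τu) {lam : ℝ} (hlam : 0 < lam) {g : HInf}
    (hg : h.op g = (lam : ℂ) • g) {x : ℝ} (hx : 0 < x) :
    extend β τd τu lam g x = (ev g x).re := by
  rw [extend, ← h.ev_op g (ofReal_mem hx), hg, re_ev_smul, inv_mul_cancel_left₀ hlam.ne']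

lemma Admissible.extend_pos (h : Admissible β τd τu) {lam : ℝ} (hlam : 0 < lam) {g : HInf}
    (hc : InCone g) (hg0 : g ≠ 0) {x : ℝ} (hx : 0 ≤ x) : 0 < extend β τd τu lam g x :=
  mul_pos (inv_pos.2 hlam) ((mul_pos (weightR_pos h.td_pos h.tu_pos (0, 0) hx)
    (hc.pos hg0 (branchR_pos (0, 0) hx))).trans_le
    (h.term_le_series (fun _ hy _ => hc.nonneg hy) (0, 0) hx))

lemma exists_max_ratio {u G : ℝ → ℝ} (hu : ContinuousOn u (Set.Icc 0 1))
    (hG : ContinuousOn G (Set.Icc 0 1)) (hpos : ∀ x ∈ Set.Icc (0 : ℝ) 1, 0 < G x) :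
    ∃ x₀ ∈ Set.Icc (0 : ℝ) 1, ∃ V : ℝ, u x₀ = V * G x₀ ∧
      ∀ x ∈ Set.Icc (0 : ℝ) 1, u x ≤ V * G x := by
  obtain ⟨x₀, hx₀, hmax⟩ := isCompact_Icc.exists_isMaxOn (Set.nonempty_Icc.2 zero_le_one)
    (hu.div hG fun x hx => (hpos x hx).ne')
  refine ⟨x₀, hx₀, u x₀ / G x₀, (div_mul_cancel₀ _ (hpos x₀ hx₀).ne').symm, fun x hx => ?_⟩
  rw [← div_le_iff₀ (hpos x hx)]
  exact hmax hx

/-- An eigenfunction whose eigenvalue is at least `lam` in modulus is a multiple of the positive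
eigenfunction `g`. At a maximum of `|f| / g` on `[0, 1]` every inequality in the estimate
`|M↓ M↑ f| ≤ max (|f| / g) · M↓ M↑ g` is an equality, so `f` and `g` are proportional at all
images of the maximum point under the branches, and these accumulate at `1`. -/
lemma Admissible.exists_eq_smul (h : Admissible β τd τu) {lam : ℝ} (hlam : 0 < lam) {g : HInf}
    (hc : InCone g) (hg0 : g ≠ 0) (hg : h.op g = (lam : ℂ) • g) {μ : ℂ} (hμ : lam ≤ ‖μ‖)
    {f : HInf} (hf : h.op f = μ • f) : ∃ c : ℂ, f = c • g := by
  have hμ0 : μ ≠ 0 := norm_pos_iff.1 (hlam.trans_le hμ)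
  have hf_eq : ∀ x : ℝ, 0 < x → μ⁻¹ * series β τd τu f x = ev f x := fun x hx => by
    rw [← h.ev_op f (ofReal_mem hx), hf, ev_smul, inv_mul_cancel_left₀ hμ0]
  obtain ⟨x₀, hx₀, M, hM, hmax⟩ := exists_max_ratio
    (u := fun x => ‖μ⁻¹ * series β τd τu f x‖)
    (continuousOn_const.mul (h.continuousOn_series_ofReal f)).norm (h.continuousOn_extend lam g)
    fun x hx => h.extend_pos hlam hc hg0 hx.1
  have hle : ∀ y : ℝ, 0 < y → y ≤ 1 → ‖ev f y‖ ≤ M * (ev g y).re := fun y hy hy1 => by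
    have := hmax y ⟨hy.le, hy1⟩
    rwa [hf_eq y hy, h.extend_eq hlam hg hy] at this
  -- rotate `f` so that the value at the maximum point is nonnegative
  obtain ⟨ω, hω1, hω⟩ : ∃ ω : ℂ, ‖ω‖ = 1 ∧
      (ω * series β τd τu f x₀).re = ‖series β τd τu f x₀‖ := by
    rcases eq_or_ne (series β τd τu f x₀) 0 with h0 | h0
    · exact ⟨1, by simp, by simp [h0]⟩
    · have hn : (‖series β τd τu f x₀‖ : ℂ) ≠ 0 := Complex.ofReal_ne_zero.2 (norm_ne_zero_iff.2 h0)
      refine ⟨‖series β τd τu f x₀‖ / series β τd τu f x₀, ?_, ?_⟩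
      · rw [norm_div, Complex.norm_real, norm_norm, div_self (norm_ne_zero_iff.2 h0)]
      · rw [div_mul_cancel₀ _ h0, Complex.ofReal_re]
  have hω0 : ω ≠ 0 := norm_ne_zero_iff.1 (by rw [hω1]; exact one_ne_zero)
  have hle' : ∀ p : ℕ × ℕ, ‖ev (ω • f) (branchR p x₀)‖ ≤ M * (ev g (branchR p x₀)).re := fun p => by
    rw [ev_smul, norm_mul, hω1, one_mul]
    exact hle _ (branchR_pos p hx₀.1) (branchR_le_one p hx₀.1)
  have hsum : M * (series β τd τu g x₀).re ≤ (series β τd τu (ω • f) x₀).re := by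
    have hE := h.extend_pos hlam hc hg0 hx₀.1
    have hM0 : 0 ≤ M := nonneg_of_mul_nonneg_left (hM ▸ norm_nonneg _) hE
    have h1 : (series β τd τu g x₀).re = lam * extend β τd τu lam g x₀ := by
      rw [extend, mul_inv_cancel_left₀ hlam.ne']
    have h2 : ‖series β τd τu f x₀‖ = ‖μ‖ * (M * extend β τd τu lam g x₀) := by
      rw [← hM, norm_mul, norm_inv, mul_inv_cancel_left₀ (norm_ne_zero_iff.2 hμ0)]
    rw [series_smul, hω, h1, h2, mul_left_comm]
    exact mul_le_mul_of_nonneg_right hμ (mul_nonneg hM0 hE.le)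
  have heq : ∀ p : ℕ × ℕ, ev (ω • f) (branchR p x₀) = (M : ℂ) * ev g (branchR p x₀) := by
    intro p
    have hw := weightR_pos (β := β) h.td_pos h.tu_pos p hx₀.1
    have h1 : M * (ev g (branchR p x₀)).re ≤ (ev (ω • f) (branchR p x₀)).re := by
      by_contra! hlt
      refine absurd hsum (not_le.2 ?_)
      refine hasSum_lt (fun q => ?_) ?_ (h.hasSum_re (ω • f) hx₀.1)
        ((h.hasSum_re g hx₀.1).mul_left M) (i := p)
      · rw [mul_left_comm]
        exact mul_le_mul_of_nonneg_left ((Complex.re_le_norm _).trans (hle' q))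
          (weightR_pos h.td_pos h.tu_pos q hx₀.1).le
      · rw [mul_left_comm]
        exact mul_lt_mul_of_pos_left hlt hw
    have h2 : (ev (ω • f) (branchR p x₀)).re = M * (ev g (branchR p x₀)).re :=
      le_antisymm ((Complex.re_le_norm _).trans (hle' p)) h1
    have h3 := Complex.re_eq_norm.1 (le_antisymm (Complex.re_le_norm _) ((hle' p).trans h1))
    rw [hc.eq_ofReal (branchR_pos p hx₀.1), ← Complex.ofReal_mul, ← h2]
    exact Complex.ext (by simp) (by simpa using (Complex.nonneg_iff.1 h3).2.symm)
  have hk : ω • f - (M : ℂ) • g = 0 := by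
    refine eq_zero_of_frequently (ofReal_mem one_pos) ?_
    have h1 : Tendsto (fun m : ℕ => ((branchR (m, 0) x₀ : ℝ) : ℂ)) atTop (𝓝[≠] ((1 : ℝ) : ℂ)) := by
      refine tendsto_nhdsWithin_iff.2 ⟨(Complex.continuous_ofReal.tendsto _).comp ?_,
        Eventually.of_forall fun m => ?_⟩
      · have h2 : Tendsto (fun m : ℕ => 1 - 1 / (x₀ + m + 2)) atTop (𝓝 (1 - 0)) := by
          refine tendsto_const_nhds.sub (Tendsto.const_div_atTop ?_ 1)
          exact tendsto_atTop_add_const_right _ _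
            (tendsto_atTop_add_const_left _ _ tendsto_natCast_atTop_atTop)
        rw [sub_zero] at h2
        exact h2.congr fun m => (branchR_snd_zero m hx₀.1).symm
      · refine Complex.ofReal_injective.ne ?_
        rw [branchR_snd_zero m hx₀.1]
        have hx0 := hx₀.1
        have : (0 : ℝ) < 1 / (x₀ + m + 2) := by positivity
        linarith
    refine h1.frequently (Frequently.of_forall fun m => ?_)
    rw [ev_sub, heq, ev_smul, sub_self]
  refine ⟨ω⁻¹ * M, ?_⟩
  rw [mul_smul, ← sub_eq_zero.1 hk, inv_smul_smul₀ hω0]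

/-- There is no Jordan chain above the positive eigenfunction `g`: if `M↓ M↑ f = lam f + c g`,
then at a maximum of `Re (c̄ f) / g` on `[0, 1]` one gets `|c|² g ≤ 0`. -/
lemma Admissible.eq_zero_of_jordan (h : Admissible β τd τu) {lam : ℝ} (hlam : 0 < lam) {g : HInf}
    (hc : InCone g) (hg0 : g ≠ 0) (hg : h.op g = (lam : ℂ) • g) {f : HInf} {c : ℂ}
    (hf : h.op f = (lam : ℂ) • f + c • g) : c = 0 := by
  set f' : HInf := (starRingEnd ℂ c) • f with hf'
  have hTf' : h.op f' = (lam : ℂ) • f' + ((Complex.normSq c : ℝ) : ℂ) • g := by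
    rw [hf', map_smul, hf, smul_add, smul_smul, smul_smul, smul_smul, Complex.normSq_eq_conj_mul_self,
      mul_comm (starRingEnd ℂ c) (lam : ℂ)]
  let U : ℝ → ℝ := fun x =>
    lam⁻¹ * ((series β τd τu f' x).re - Complex.normSq c * extend β τd τu lam g x)
  have hU : ContinuousOn U (Set.Icc 0 1) := continuousOn_const.mul
    ((Complex.continuous_re.comp_continuousOn (h.continuousOn_series_ofReal f')).sub
      (continuousOn_const.mul (h.continuousOn_extend lam g)))
  have hU_eq : ∀ x : ℝ, 0 < x → U x = (ev f' x).re := fun x hx => by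
    simp only [U]
    rw [← h.ev_op f' (ofReal_mem hx), h.extend_eq hlam hg hx, hTf', ev_add, Complex.add_re,
      re_ev_smul, re_ev_smul, add_sub_cancel_right, inv_mul_cancel_left₀ hlam.ne']
  obtain ⟨x₀, hx₀, V, hV, hmax⟩ := exists_max_ratio hU (h.continuousOn_extend lam g)
    fun x hx => h.extend_pos hlam hc hg0 hx.1
  have hE := h.extend_pos hlam hc hg0 hx₀.1
  have hsum : (series β τd τu f' x₀).re ≤ V * (series β τd τu g x₀).re := by
    refine hasSum_le (fun q => ?_) (h.hasSum_re f' hx₀.1) ((h.hasSum_re g hx₀.1).mul_left V)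
    rw [mul_left_comm]
    refine mul_le_mul_of_nonneg_left ?_ (weightR_pos h.td_pos h.tu_pos q hx₀.1).le
    have hq := branchR_pos q hx₀.1
    have := hmax _ ⟨hq.le, branchR_le_one q hx₀.1⟩
    rwa [hU_eq _ hq, h.extend_eq hlam hg hq] at this
  have h1 : (series β τd τu g x₀).re = lam * extend β τd τu lam g x₀ := by
    rw [extend, mul_inv_cancel_left₀ hlam.ne']
  have h2 : (series β τd τu f' x₀).re =
      lam * (V * extend β τd τu lam g x₀) + Complex.normSq c * extend β τd τu lam g x₀ := by
    rw [← hV]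
    simp only [U]
    rw [mul_inv_cancel_left₀ hlam.ne', sub_add_cancel]
  rw [h1, h2, mul_left_comm] at hsum
  have h3 : Complex.normSq c * extend β τd τu lam g x₀ ≤ 0 := by linarith
  exact Complex.normSq_eq_zero.1
    (le_antisymm (nonpos_of_mul_nonpos_left h3 hE) (Complex.normSq_nonneg c))

/-! ### The leading eigenvalue -/

/-- A compact operator has a simple leading eigenvalue `lam > 0` as soon as the eigenfunctions for
eigenvalues of modulus at least `lam` are the multiples of one eigenvector, over which there is
no Jordan chain. -/
lemma isSimpleLeadingEigenvalue_of_isCompactOperator {E : Type*} [NormedAddCommGroup E]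
    [NormedSpace ℂ E] [CompleteSpace E] {T : E →L[ℂ] E} (hT : IsCompactOperator T) {lam : ℝ}
    (hlam : 0 < lam) {g : E} (hg0 : g ≠ 0) (hg : T g = (lam : ℂ) • g)
    (hspan : ∀ (μ : ℂ) (f : E), lam ≤ ‖μ‖ → T f = μ • f → ∃ c : ℂ, f = c • g)
    (hjordan : ∀ (c : ℂ) (f : E), T f = (lam : ℂ) • f + c • g → c = 0) :
    IsSimpleLeadingEigenvalue T (lam : ℂ) := by
  have hnorm : ‖(lam : ℂ)‖ = lam := Complex.norm_of_nonneg hlam.le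
  have hgen : ∀ (k : ℕ) (f : E),
      (((T : Module.End ℂ E) - (lam : ℂ) • (1 : Module.End ℂ E)) ^ k) f = 0 →
        ∃ c : ℂ, f = c • g := by
    intro k
    induction k with
    | zero => exact fun f hf => ⟨0, by simpa using hf⟩
    | succ k ih =>
      intro f hf
      rw [pow_succ, Module.End.mul_apply] at hf
      obtain ⟨c, hc⟩ := ih _ hf
      have hc : T f - (lam : ℂ) • f = c • g := hc
      have hTf := sub_eq_iff_eq_add'.1 hc
      rw [hjordan c f hTf, zero_smul, add_zero] at hTf
      exact hspan lam f hnorm.ge hTf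
  have hmem : g ∈ Module.End.eigenspace (T : Module.End ℂ E) (lam : ℂ) :=
    Module.End.mem_eigenspace_iff.2 hg
  refine ⟨Module.End.hasEigenvalue_of_hasEigenvector ⟨hmem, hg0⟩, ?_, ?_⟩
  · have hmax : Module.End.maxGenEigenspace (T : Module.End ℂ E) (lam : ℂ) =
        Submodule.span ℂ {g} := by
      refine le_antisymm (fun f hf => ?_) ?_
      · obtain ⟨k, hk⟩ := Module.End.mem_maxGenEigenspace _ _ _ |>.1 hf
        obtain ⟨c, rfl⟩ := hgen k f hk
        exact Submodule.smul_mem _ _ (Submodule.mem_span_singleton_self g)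
      · rw [Submodule.span_singleton_le_iff_mem, Module.End.mem_maxGenEigenspace]
        refine ⟨1, ?_⟩
        rw [pow_one]
        exact sub_eq_zero.2 hg
    rw [hmax, finrank_span_singleton hg0]
  · intro μ hμ hne
    by_contra! hle
    rw [hnorm] at hle
    have hμ0 : μ ≠ 0 := norm_pos_iff.1 (hlam.trans_le hle)
    obtain ⟨f, hf⟩ := ((hT.hasEigenvalue_iff_mem_spectrum hμ0).2 hμ).exists_hasEigenvector
    have hf1 : T f = μ • f := hf.apply_eq_smul
    obtain ⟨c, hfc⟩ := hspan μ f hle hf1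
    have h1 : (μ - (lam : ℂ)) • f = 0 := by
      rw [sub_smul, ← hf1, hfc, map_smul, hg, smul_comm, sub_self]
    rcases smul_eq_zero.1 h1 with h2 | h2
    · exact hne (sub_eq_zero.1 h2)
    · exact hf.2 h2

end FareyChain


theorem mainTheorem2 (β : ℝ) (hβ : 1 / 2 < β) (τd τu : ℝ)
    (hd0 : 0 < τd) (hd1 : τd ≤ 1) (hu0 : 0 < τu) (hu1 : τu ≤ 1) :
    -- the series defining the operator converges in operator norm
    Summable (FareyChain.clusterTerm β (one_half_pos.le.trans hβ.le) τd τu) ∧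
    -- for parameters below one it is the product of the two cluster operators
    (τd < 1 → τu < 1 →
      IsUnit (1 - (τd : ℂ) • FareyChain.LDown) ∧
      IsUnit (1 - (τu : ℂ) • FareyChain.LUp β (one_half_pos.le.trans hβ.le)) ∧
      FareyChain.clusterOp β (one_half_pos.le.trans hβ.le) τd τu =
        FareyChain.MDown τd * FareyChain.MUp β (one_half_pos.le.trans hβ.le) τu) ∧
    IsCompactOperator (FareyChain.clusterOp β (one_half_pos.le.trans hβ.le) τd τu) ∧
    ∃ lam : ℝ, 0 < lam ∧
      FareyChain.IsSimpleLeadingEigenvalue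
        (FareyChain.clusterOp β (one_half_pos.le.trans hβ.le) τd τu) (lam : ℂ) := by
  have h : FareyChain.Admissible β τd τu := ⟨hβ, hd0, hd1, hu0, hu1⟩
  refine ⟨h.summable_clusterTerm, fun hd hu => ⟨?_, ?_, ?_⟩, h.isCompactOperator_op, ?_⟩
  · exact FareyChain.isUnit_one_sub_of_opNorm_lt_one
      (FareyChain.norm_smul_lt_one hd0 hd FareyChain.norm_LDown_le)
  · exact FareyChain.isUnit_one_sub_of_opNorm_lt_one
      (FareyChain.norm_smul_lt_one hu0 hu (FareyChain.norm_LUp_le _))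
  · exact FareyChain.clusterOp_eq_mul _ hd0 hd hu0 hu
  · obtain ⟨lam, hlam, g, hc, hg0, hg⟩ := h.exists_eigenfunction
    exact ⟨lam, hlam, FareyChain.isSimpleLeadingEigenvalue_of_isCompactOperator
      h.isCompactOperator_op hlam hg0 hg
      (fun μ f hμ hf => h.exists_eq_smul hlam hc hg0 hg hμ hf)
      (fun c f hf => h.eq_zero_of_jordan hlam hc hg0 hg hf)⟩
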